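/- Call a finite set $\mathbf P\subset\mathbb R^3$ a \emph{polyhedron} if its points are not all contained in one plane and are in convex position (no point of $\mathbf P$ lies in the convex hull of the others), and write $\overline{\mathbf P}$ for its convex hull. A polyhedron $\mathbf P$ is \emph{Rupert} if there are a polyhedron $\mathbf Q$ congruent to $\mathbf P$ and a nonzero vector $v\in\mathbb R^3$ such that $$\overline{\mathbf P}\setminus\{q+tv : q\in\overline{\mathbf Q},\ t\in\mathbb R\}$$ is a set with a hole, i.e. a set whose interior in $\mathbb R^3$ is connected but not simply connected. For real numbers $x,y,\alpha,\theta,\varphi$ let $$T_{x,y}\begin{pmatrix}a\\b\end{pmatrix}=\begin{pmatrix}a+x\\b+y\end{pmatrix},\qquad R_\alpha=\begin{pmatrix}\cos\alpha&-\sin\alpha\\ \sin\alpha&\cos\alpha\end{pmatrix},\qquad M_{\theta,\varphi}=\begin{pmatrix}-\sin\theta&\cos\theta&0\\-\cos\theta\cos\varphi&-\sin\theta\cos\varphi&\sin\varphi\end{pmatrix},$$ acting elementwise on sets of points, and for a finite set $\mathcal Q\subset\mathbb R^2$ let $\mathcal Q^\circ$ be the interior of its convex hull. \textbf{Proposition.}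 A polyhedron $\mathbf P$ is Rupert if and only if there exist $x,y\in\mathbb R$, $\alpha,\theta_1,\theta_2\in[0,2\pi)$ and $\varphi_1,\varphi_2\in[0,\pi]$ such that $$(T_{x,y}\circ R_\alpha\circ M_{\theta_1,\varphi_1})(\mathbf P)\subset M_{\theta_2,\varphi_2}(\mathbf P)^\circ .$$ -/

import Mathlib

open Real

noncomputable section

namespace Rupert

/-- Euclidean space `ℝ³`. -/
abbrev E3 : Type := EuclideanSpace ℝ (Fin 3)

/-- The Euclidean plane `ℝ²`. -/
abbrev E2 : Type := EuclideanSpace ℝ (Fin 2)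

/-- A polyhedron, given by its vertices: a finite set of points of `ℝ³` which is non-degenerate
(it is not contained in a plane) and in convex position (no point lies in the convex hull of the
others). The solid body is `convexHull ℝ P`. -/
structure IsPolyhedron (P : Set E3) : Prop where
  finite : P.Finite
  nondegenerate : affineSpan ℝ P = ⊤
  convexPosition : ConvexIndependent ℝ (Subtype.val : P → E3)

/-- `P` and `Q` have the same shape and size. -/
def SameShapeAndSize (P Q : Set E3) : Prop :=
  ∃ g : E3 ≃ᵢ E3, Q = g '' P

/-- The infinite straight tunnel swept out by the solid body with vertex set `Q` when it is moved
along the straight line with direction `v`. -/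
def tunnel (Q : Set E3) (v : E3) : Set E3 :=
  {x | ∃ q ∈ convexHull ℝ Q, ∃ t : ℝ, x = q + t • v}

/-- A set with a hole: its interior is connected but not simply connected. -/
def HasHole (A : Set E3) : Prop :=
  IsConnected (interior A) ∧ ¬ IsSimplyConnected (interior A)

/-- Rupert's property: removing the tunnel of a congruent copy of the body from the body,
in some direction, leaves a set with a hole. -/
def IsRupert (P : Set E3) : Prop :=
  ∃ Q : Set E3, IsPolyhedron Q ∧ SameShapeAndSize P Q ∧
    ∃ v : E3, v ≠ 0 ∧ HasHole (convexHull ℝ P \ tunnel Q v)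

/-- The projection of `ℝ³` along the direction `(cos θ sin φ, sin θ sin φ, cos φ)`. -/
def M (θ φ : ℝ) (p : E3) : E2 :=
  !₂[-sin θ * p 0 + cos θ * p 1,
    -cos θ * cos φ * p 0 - sin θ * cos φ * p 1 + sin φ * p 2]

/-- The counter-clockwise rotation of the plane by the angle `α` about the origin. -/
def R (α : ℝ) (p : E2) : E2 :=
  !₂[p 0 * cos α - p 1 * sin α, p 0 * sin α + p 1 * cos α]

/-- The translation of the plane by `(x, y)`. -/
def T (x y : ℝ) (p : E2) : E2 :=
  !₂[p 0 + x, p 1 + y]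

/-- The interior of the polygon spanned by a set of points of the plane. -/
def polygonInterior (S : Set E2) : Set E2 :=
  interior (convexHull ℝ S)

end Rupert

end

noncomputable section

namespace Rupert

/-! Project along the tunnel's direction, with the plane viewed as `ℂ`. The tunnel becomes `p ⁻¹' B`
with `B` a compact convex polygon, so the interior in question is `U = C ∩ p ⁻¹' Bᶜ` with `C` open
and convex. The core is `hasHole_sdiff_preimage_iff`: a hole means exactly `B ⊆ p '' C`. Fix `b ∈ B`
and cut `U` into fibres over the rays from `b`; these are convex, so continuous selections exist. If
`B ⊆ p '' C`, every ray is met: a loop in `U` winds once around `b`, and `U` is connected but not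
simply connected. If some `b ∈ B` lies outside `p '' C`, that image lies in an open half-plane
bounded by a line through `b`. When `U` is connected, the rays met form an interval, to which `U` is
homotopy equivalent. Finally, congruences of `P` followed by a projection are exactly the maps `T ∘
R ∘ M`. -/

/-! ### Ray fibres and topological tools -/

theorem add_smul_mem_of_le {B : Set ℂ} (hB : Convex ℝ B) {b w : ℂ} (hb : b ∈ B) {r t : ℝ}
    (hr : 0 < r) (hrt : r ≤ t) (ht : b + t • w ∈ B) : b + r • w ∈ B := by
  have h0 : 0 < t := hr.trans_le hrt
  have := hB.add_smul_sub_mem hb ht (t := r / t) ⟨by positivity, (div_le_one h0).2 hrt⟩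
  rwa [add_sub_cancel_left, smul_smul, div_mul_cancel₀ _ h0.ne'] at this

/-- The points of `C` lying over the part outside `B` of the ray from `b` in direction `w`. -/
def rayFibre {E : Type*} (p : E → ℂ) (C : Set E) (B : Set ℂ) (b w : ℂ) : Set E :=
  {x | x ∈ C ∧ p x ∉ B ∧ ∃ r : ℝ, 0 < r ∧ p x = b + r • w}

/-- A ray from `b ∈ B` that has left the convex set `B` never re-enters it, so the parameters
outside `B` are closed upwards. -/
theorem convex_rayFibre {E : Type*} [NormedAddCommGroup E] [NormedSpace ℝ E] (p : E →L[ℝ] ℂ)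
    {C : Set E} (hC : Convex ℝ C) {B : Set ℂ} (hB : Convex ℝ B) {b : ℂ} (hb : b ∈ B) (w : ℂ) :
    Convex ℝ (rayFibre p C B b w) := by
  rintro x ⟨hx, hxB, r, hr, hxr⟩ y ⟨hy, hyB, s, hs, hys⟩ a c ha hc hac
  have key : p (a • x + c • y) = b + (a * r + c * s) • w := by
    rw [map_add, map_smul, map_smul, hxr, hys]
    have : b = (a + c) • b := by rw [hac, one_smul]
    nth_rewrite 3 [this]
    module
  have hle : min r s ≤ a * r + c * s := by
    nlinarith [min_le_left r s, min_le_right r s]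
  refine ⟨hC hx hy ha hc hac, fun hmem => ?_, a * r + c * s,
    (lt_min hr hs).trans_le hle, key⟩
  rw [key] at hmem
  rcases min_le_iff.1 hle with h | h
  · exact hxB (hxr ▸ add_smul_mem_of_le hB hb hr h hmem)
  · exact hyB (hys ▸ add_smul_mem_of_le hB hb hs h hmem)

theorem exists_continuous_mem_rayFibre {E : Type*} [NormedAddCommGroup E] [NormedSpace ℝ E]
    {X : Type*} [TopologicalSpace X] [NormalSpace X] [ParacompactSpace X]
    (p : E →L[ℝ] ℂ) (hp : Function.Surjective p)
    {C : Set E} (hC : Convex ℝ C) (hCo : IsOpen C) {B : Set ℂ} (hB : Convex ℝ B)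
    (hBc : IsClosed B) {b : ℂ} (hb : b ∈ B) (w : C(X, ℂ))
    (hne : ∀ m, (rayFibre p C B b (w m)).Nonempty) :
    ∃ g : C(X, E), ∀ m, g m ∈ rayFibre p C B b (w m) := by
  refine exists_continuous_forall_mem_convex_of_local
    (fun m => convex_rayFibre p hC hB hb (w m)) fun m => ?_
  obtain ⟨x, hx, hxB, r, hr, hxr⟩ := hne m
  obtain ⟨l, hl⟩ := p.toLinearMap.exists_rightInverse_of_surjective
    (LinearMap.range_eq_top.2 hp)
  have hl' : ∀ z, p (l z) = z := fun z => LinearMap.congr_fun hl z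
  -- Local selection: a linear lift moves `x` onto the nearby ray at the same parameter `r`.
  let g : X → E := fun n => x + r • l.toContinuousLinearMap (w n - w m)
  have hg : Continuous g := by fun_prop
  have hgm : g m = x := by simp [g]
  have ho : IsOpen (C ∩ p ⁻¹' Bᶜ) := hCo.inter (hBc.isOpen_compl.preimage p.continuous)
  refine ⟨g ⁻¹' (C ∩ p ⁻¹' Bᶜ), hg.continuousAt.preimage_mem_nhds
    (ho.mem_nhds (by rw [hgm]; exact ⟨hx, hxB⟩)), g, hg.continuousOn, fun n hn =>
    ⟨hn.1, hn.2, r, hr, ?_⟩⟩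
  simp only [g, map_add, map_smul, LinearMap.coe_toContinuousLinearMap', hl', hxr]
  module

theorem nonempty_homotopyEquiv_of_segment_subset {E : Type*} [NormedAddCommGroup E]
    [NormedSpace ℝ E] {X : Type*} [TopologicalSpace X] {U : Set E} (f : C(U, X)) (g : C(X, U))
    (hfg : ∀ m, f (g m) = m) (hseg : ∀ x : U, segment ℝ ((g (f x) : U) : E) x ⊆ U) :
    Nonempty (ContinuousMap.HomotopyEquiv U X) := by
  have hmem : ∀ q : unitInterval × U,
      AffineMap.lineMap ((g (f q.2) : U) : E) (q.2 : E) (q.1 : ℝ) ∈ U := fun q =>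
    hseg q.2 (by rw [segment_eq_image_lineMap]; exact ⟨q.1, q.1.2, rfl⟩)
  refine ⟨⟨f, g, ⟨⟨⟨fun q => ⟨_, hmem q⟩, ?_⟩, fun x => ?_, fun x => ?_⟩⟩, ?_⟩⟩
  · refine Continuous.subtype_mk ?_ _
    simp only [AffineMap.lineMap_apply_module]
    fun_prop
  · ext; simp
  · ext; simp
  · rw [show f.comp g = ContinuousMap.id X from ContinuousMap.ext hfg]

/-- On a simply connected `U`, `h` would have a continuous logarithm; pulled back along `g`, its
imaginary part would be a continuous argument on the circle. -/
theorem not_isSimplyConnected_of_circle_section {E : Type*} [NormedAddCommGroup E]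
    [NormedSpace ℝ E] {U : Set E} (hU : IsOpen U) (h : E → ℂ) (hc : Continuous h)
    (h0 : ∀ x ∈ U, h x ≠ 0) (g : C(Metric.sphere (0 : ℂ) 1, E)) (hgU : ∀ z, g z ∈ U)
    (hg : ∀ z, ∃ r : ℝ, 0 < r ∧ h (g z) = r • (z : ℂ)) : ¬ IsSimplyConnected U := by
  intro hsc
  obtain ⟨f, hf, hexp⟩ := Complex.exists_continuousOn_eqOn_exp_comp hsc hU hc.continuousOn
    (by rintro ⟨x, hx, hx0⟩; exact h0 x hx hx0)
  let k : Metric.sphere (0 : ℂ) 1 → ℝ := fun z => (f (g z)).im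
  have hk : Continuous k :=
    Complex.continuous_im.comp (hf.comp_continuous g.continuous hgU)
  have hkz : ∀ z, Complex.exp (k z * Complex.I) = z := fun z => by
    obtain ⟨r, hr, hrz⟩ := hg z
    have h1 : Complex.exp (f (g z)) = r • (z : ℂ) := (hexp (hgU z)).trans hrz
    have hz : ‖(z : ℂ)‖ = 1 := by simp
    have h2 : Real.exp (f (g z)).re = r := by
      rw [← Complex.norm_exp, h1, norm_smul, hz, mul_one, Real.norm_of_nonneg hr.le]
    rw [← Complex.re_add_im (f (g z)), Complex.exp_add, ← Complex.ofReal_exp, h2,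
      Complex.real_smul] at h1
    exact mul_left_cancel₀ (Complex.ofReal_ne_zero.2 hr.ne') h1
  have hconn : PreconnectedSpace (Metric.sphere (0 : ℂ) 1) :=
    isPreconnected_iff_preconnectedSpace.1 (isPreconnected_sphere
      (by rw [Complex.rank_real_complex]; exact Nat.one_lt_ofNat) 0 1)
  -- An odd function on the connected circle has a zero, where `z` and `-z` share an argument.
  let d : Metric.sphere (0 : ℂ) 1 → ℝ := fun z => k z - k (-z)
  have hd : Continuous d := hk.sub (hk.comp continuous_neg)
  let o : Metric.sphere (0 : ℂ) 1 := ⟨1, by simp⟩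
  have hodd : d (-o) = - d o := by simp [d]
  obtain ⟨z, hz⟩ : ∃ z, d z = 0 := by
    rcases le_total (d o) 0 with h | h
    · exact mem_range_of_exists_le_of_exists_ge hd ⟨o, h⟩ ⟨-o, by linarith⟩
    · exact mem_range_of_exists_le_of_exists_ge hd ⟨-o, by linarith⟩ ⟨o, h⟩
  have h1 := hkz z
  rw [sub_eq_zero.1 hz, hkz (-z)] at h1
  have h2 : (z : ℂ) = 0 := by
    have : -(z : ℂ) = z := h1
    exact self_eq_neg.1 this.symm
  have := z.2
  simp [h2] at this

theorem exists_mem_notMem_on_ray {A B : Set ℂ} (hA : IsOpen A) (hB : IsCompact B) (hBA : B ⊆ A)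
    {b : ℂ} (hb : b ∈ B) {w : ℂ} (hw : w ≠ 0) :
    ∃ r : ℝ, 0 < r ∧ b + r • w ∈ A ∧ b + r • w ∉ B := by
  let γ : ℝ → ℂ := fun t => b + t • w
  have hγ : Continuous γ := by fun_prop
  have hcl : IsClosed {t : ℝ | 0 ≤ t ∧ γ t ∈ B} :=
    isClosed_Ici.inter (hB.isClosed.preimage hγ)
  obtain ⟨D, hD⟩ := hB.isBounded.exists_norm_le
  have hbd : {t : ℝ | 0 ≤ t ∧ γ t ∈ B} ⊆ Set.Icc 0 ((D + ‖b‖) / ‖w‖) := by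
    rintro t ⟨ht, htB⟩
    refine ⟨ht, ?_⟩
    rw [le_div_iff₀ (norm_pos_iff.2 hw)]
    calc t * ‖w‖ = ‖γ t - b‖ := by simp [γ, abs_of_nonneg ht]
      _ ≤ ‖γ t‖ + ‖b‖ := norm_sub_le _ _
      _ ≤ D + ‖b‖ := by gcongr; exact hD _ htB
  -- Last point of the ray in `B`; just beyond it the ray is still in the open set `A`.
  obtain ⟨t₀, ⟨ht₀, ht₀B⟩, hmax⟩ := (isCompact_Icc.of_isClosed_subset hcl hbd).exists_isGreatest
    ⟨0, le_rfl, by simpa [γ] using hb⟩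
  have hev : ∀ᶠ t in nhdsWithin t₀ (Set.Ioi t₀), γ t ∈ A :=
    nhdsWithin_le_nhds (hγ.continuousAt.preimage_mem_nhds (hA.mem_nhds (hBA ht₀B)))
  obtain ⟨t, htA, ht⟩ := (hev.and self_mem_nhdsWithin).exists
  have ht' : t₀ < t := ht
  exact ⟨t, ht₀.trans_lt ht', htA, fun h => absurd (hmax ⟨ht₀.trans ht'.le, h⟩) (not_le.2 ht')⟩

/-! ### The criterion for a hole -/

section

variable {E : Type*} [NormedAddCommGroup E] [NormedSpace ℝ E]

theorem segment_subset_of_mem_rayFibre (p : E →L[ℝ] ℂ)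
    {C : Set E} (hC : Convex ℝ C) {B : Set ℂ} (hB : Convex ℝ B) {b : ℂ} (hb : b ∈ B) {w : ℂ}
    {x y : E} (hx : x ∈ rayFibre p C B b w) (hy : y ∈ rayFibre p C B b w) :
    segment ℝ x y ⊆ C ∩ p ⁻¹' Bᶜ := fun _ hz =>
  have h := (convex_rayFibre p hC hB hb w).segment_subset hx hy hz
  ⟨h.1, h.2.1⟩

theorem isConnected_and_not_isSimplyConnected_of_subset [CompleteSpace E] (p : E →L[ℝ] ℂ)
    (hp : Function.Surjective p) {C : Set E} (hC : Convex ℝ C) (hCo : IsOpen C) {B : Set ℂ}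
    (hB : Convex ℝ B) (hBc : IsCompact B) (hne : B.Nonempty) (hBC : B ⊆ p '' C) :
    IsConnected (C ∩ p ⁻¹' Bᶜ) ∧ ¬ IsSimplyConnected (C ∩ p ⁻¹' Bᶜ) := by
  obtain ⟨b, hb⟩ := hne
  let w : C(Metric.sphere (0 : ℂ) 1, ℂ) := ⟨Subtype.val, continuous_subtype_val⟩
  have hw0 : ∀ z, w z ≠ 0 := fun z hz => by
    have := z.2
    rw [show (z : ℂ) = 0 from hz] at this
    simp at this
  obtain ⟨g, hg⟩ := exists_continuous_mem_rayFibre p hp hC hCo hB hBc.isClosed hb w fun z => by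
    obtain ⟨r, hr, ⟨x, hx, hxr⟩, hB'⟩ :=
      exists_mem_notMem_on_ray (p.isOpenMap hp C hCo) hBc hBC hb (hw0 z)
    exact ⟨x, hx, hxr ▸ hB', r, hr, hxr⟩
  have hgU : ∀ z, g z ∈ C ∩ p ⁻¹' Bᶜ := fun z => ⟨(hg z).1, (hg z).2.1⟩
  have h0 : ∀ x ∈ C ∩ p ⁻¹' Bᶜ, p x - b ≠ 0 := fun x hx h => hx.2 (sub_eq_zero.1 h ▸ hb)
  refine ⟨IsPathConnected.isConnected ?_, not_isSimplyConnected_of_circle_section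
    (hCo.inter (hBc.isClosed.isOpen_compl.preimage p.continuous)) (fun x => p x - b)
    (by fun_prop) h0 g hgU fun z => ?_⟩
  · have hS : IsPathConnected (Set.univ : Set (Metric.sphere (0 : ℂ) 1)) :=
      pathConnectedSpace_iff_univ.1 (isPathConnected_iff_pathConnectedSpace.1
        (isPathConnected_sphere (by rw [Complex.rank_real_complex]; exact Nat.one_lt_ofNat) 0
          zero_le_one))
    have hG := hS.image g.continuous
    have hGU : g '' Set.univ ⊆ C ∩ p ⁻¹' Bᶜ := by rintro _ ⟨z, -, rfl⟩; exact hgU z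
    obtain ⟨y, hy, hyj⟩ := hG
    refine ⟨y, hGU hy, fun {x} hx => ?_⟩
    have hx0 : 0 < ‖p x - b‖ := norm_pos_iff.2 (h0 x hx)
    let z : Metric.sphere (0 : ℂ) 1 := ⟨‖p x - b‖⁻¹ • (p x - b), by
      simp [hx0.ne']⟩
    have hxz : x ∈ rayFibre p C B b (w z) := ⟨hx.1, hx.2, _, hx0, by
      change _ = b + ‖p x - b‖ • ‖p x - b‖⁻¹ • (p x - b)
      rw [smul_inv_smul₀ hx0.ne', add_sub_cancel]⟩
    -- Each `x` is joined to the loop by a segment inside its own fibre.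
    exact ((hyj ⟨z, trivial, rfl⟩).mono hGU).trans
      (JoinedIn.of_segment_subset (segment_subset_of_mem_rayFibre p hC hB hb (hg z) hxz))
  · obtain ⟨-, -, r, hr, h⟩ := hg z
    exact ⟨r, hr, by simp [h, w]⟩

theorem isSimplyConnected_of_notMem [CompleteSpace E] (p : E →L[ℝ] ℂ)
    (hp : Function.Surjective p) {C : Set E} (hC : Convex ℝ C) (hCo : IsOpen C) {B : Set ℂ}
    (hB : Convex ℝ B) (hBc : IsClosed B) {b : ℂ} (hb : b ∈ B) (hbC : b ∉ p '' C)
    (hconn : IsConnected (C ∩ p ⁻¹' Bᶜ)) : IsSimplyConnected (C ∩ p ⁻¹' Bᶜ) := by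
  obtain ⟨φ, hφ⟩ := geometric_hahn_banach_open_point
    (hC.linear_image p.toLinearMap) (p.isOpenMap hp C hCo) hbC
  replace hφ : ∀ x ∈ C, 0 < φ b - φ (p x) := fun x hx => sub_pos.2 (hφ _ ⟨x, hx, rfl⟩)
  have hφz : ∀ z : ℂ, φ z = φ 1 * z.re + φ Complex.I * z.im := fun z => by
    have : z = z.re • (1 : ℂ) + z.im • Complex.I := by simp
    conv_lhs => rw [this, map_add, map_smul, map_smul]
    simp [mul_comm]
  set α := φ 1
  set β := φ Complex.I
  obtain ⟨x₀, hx₀⟩ := hconn.nonempty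
  have hN : 0 < α ^ 2 + β ^ 2 := by
    by_contra h
    have h1 : α = 0 := by nlinarith [sq_nonneg α, sq_nonneg β]
    have h2 : β = 0 := by nlinarith [sq_nonneg α, sq_nonneg β]
    have := hφ x₀ hx₀.1
    simp [hφz, h1, h2] at this
  set N := α ^ 2 + β ^ 2
  let ψ : ℂ → ℝ := fun z => α * z.im - β * z.re
  have hψ : Continuous ψ := by fun_prop
  -- Rays entering the half-plane are indexed by slope in the coordinates `-φ`, `ψ` centred at `b`.
  let slope : ↥(C ∩ p ⁻¹' Bᶜ) → ℝ := fun x => ψ (p x - b) / (φ b - φ (p x))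
  have hslope : Continuous slope := by
    refine Continuous.div (by fun_prop) (by fun_prop) fun x => (hφ x x.2.1).ne'
  let X := Set.range slope
  let f : C(↥(C ∩ p ⁻¹' Bᶜ), X) := ⟨Set.rangeFactorization slope, by fun_prop⟩
  -- The vector with `φ = -1` and `ψ = m`, so the ray parameter of `x` is `φ b - φ (p x)`.
  let w : C(X, ℂ) := ⟨fun m => ⟨(-α - β * m) / N, (-β + α * m) / N⟩, by
    simp only [Complex.mk_eq_add_mul_I]; fun_prop⟩
  have hfw : ∀ x : ↥(C ∩ p ⁻¹' Bᶜ), (x : E) ∈ rayFibre p C B b (w (f x)) := fun x => by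
    have hP := hφ x x.2.1
    refine ⟨x.2.1, x.2.2, _, hP, ?_⟩
    have h1 := hφz (p x)
    have h2 := hφz b
    apply Complex.ext <;>
    · simp only [f, w, slope, ψ, ContinuousMap.coe_mk, Set.rangeFactorization_coe, Complex.add_re,
        Complex.add_im, Complex.smul_re, Complex.smul_im, smul_eq_mul, Complex.sub_re,
        Complex.sub_im]
      field_simp
      rw [h1, h2]
      ring
  have hwf : ∀ (x : ↥(C ∩ p ⁻¹' Bᶜ)) (m : X), (x : E) ∈ rayFibre p C B b (w m) → f x = m := by
    rintro x m ⟨-, -, r, hr, h⟩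
    apply Subtype.ext
    change ψ (p x - b) / (φ b - φ (p x)) = m
    have h1 : φ b - φ (p x) = r := by
      rw [hφz b, hφz (p x), h]
      simp only [w, ContinuousMap.coe_mk, Complex.add_re, Complex.add_im, Complex.smul_re,
        Complex.smul_im, smul_eq_mul]
      field_simp
      ring
    rw [h1, div_eq_iff hr.ne', h]
    simp only [ψ, w, ContinuousMap.coe_mk, Complex.smul_re, Complex.smul_im, smul_eq_mul,
      add_sub_cancel_left]
    field_simp
    ring
  obtain ⟨g, hg⟩ := exists_continuous_mem_rayFibre p hp hC hCo hB hBc hb w fun m => by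
    obtain ⟨x, hx⟩ := m.2
    have : f x = m := Subtype.ext hx
    exact ⟨x, this ▸ hfw x⟩
  let g' : C(X, ↥(C ∩ p ⁻¹' Bᶜ)) :=
    ⟨fun m => ⟨g m, (hg m).1, (hg m).2.1⟩, g.continuous.subtype_mk _⟩
  obtain ⟨e⟩ := nonempty_homotopyEquiv_of_segment_subset f g' (fun m => hwf (g' m) m (hg m))
    fun x => segment_subset_of_mem_rayFibre p hC hB hb (hg (f x)) (hfw x)
  have : PreconnectedSpace ↥(C ∩ p ⁻¹' Bᶜ) :=
    isPreconnected_iff_preconnectedSpace.1 hconn.isPreconnected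
  have hX : Convex ℝ X := (isPreconnected_range hslope).ordConnected.convex
  have := hX.contractibleSpace ⟨slope ⟨x₀, hx₀⟩, Set.mem_range_self _⟩
  exact e.simplyConnectedSpace

theorem interior_sdiff_preimage (p : E →L[ℝ] ℂ) (K : Set E) {B : Set ℂ} (hB : IsClosed B) :
    interior (K \ p ⁻¹' B) = interior K ∩ p ⁻¹' Bᶜ := by
  rw [Set.sdiff_eq, interior_inter, ← Set.preimage_compl,
    (hB.isOpen_compl.preimage p.continuous).interior_eq]

/-- `p '' interior K` is open, convex and dense in `p '' K`, and an open convex set is the interior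
of its closure. -/
theorem image_interior_eq [CompleteSpace E] (p : E →L[ℝ] ℂ) (hp : Function.Surjective p)
    {K : Set E} (hK : Convex ℝ K) (hne : (interior K).Nonempty) :
    p '' interior K = interior (p '' K) := by
  have ho : IsOpen (p '' interior K) := p.isOpenMap hp _ isOpen_interior
  refine (interior_maximal (Set.image_mono interior_subset) ho).antisymm ?_
  have hcl : p '' K ⊆ closure (p '' interior K) := by
    refine (Set.image_mono ?_).trans (image_closure_subset_closure_image p.continuous)
    rw [hK.closure_interior_eq_closure_of_nonempty_interior hne]
    exact subset_closure
  have hconv : Convex ℝ (p '' interior K) := hK.interior.linear_image p.toLinearMap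
  refine (interior_mono hcl).trans_eq ?_
  rw [hconv.interior_closure_eq_interior_of_nonempty_interior
    (by rw [ho.interior_eq]; exact hne.image p), ho.interior_eq]

end

theorem hasHole_sdiff_preimage_iff (p : E3 →L[ℝ] ℂ) (hp : Function.Surjective p)
    {K : Set E3} (hK : Convex ℝ K) (hne : (interior K).Nonempty) {B : Set ℂ}
    (hB : Convex ℝ B) (hBc : IsCompact B) (hBne : B.Nonempty) :
    HasHole (K \ p ⁻¹' B) ↔ B ⊆ interior (p '' K) := by
  rw [HasHole, interior_sdiff_preimage p K hBc.isClosed, ← image_interior_eq p hp hK hne]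
  refine ⟨fun h b hb => ?_, isConnected_and_not_isSimplyConnected_of_subset p hp hK.interior
    isOpen_interior hB hBc hBne⟩
  by_contra hbC
  exact h.2 (isSimplyConnected_of_notMem p hp hK.interior isOpen_interior hB hBc.isClosed hb hbC
    h.1)

/-! ### Projections, frames and angles -/

/-- The projection `M θ φ` as a continuous linear map. -/
def projection (θ φ : ℝ) : E3 →L[ℝ] E2 :=
  LinearMap.toContinuousLinearMap
    { toFun := M θ φ
      map_add' := fun p q => by ext i; fin_cases i <;> simp [M] <;> ring
      map_smul' := fun c p => by ext i; fin_cases i <;> simp [M] <;> ring }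

@[simp] theorem projection_apply (θ φ : ℝ) (p : E3) : projection θ φ p = M θ φ p := rfl

/-- The unit vector with spherical coordinates `θ`, `φ`. -/
def direction (θ φ : ℝ) : E3 := !₂[cos θ * sin φ, sin θ * sin φ, cos φ]

/-- The coordinates of a point with respect to the two rows of `M θ φ` rotated by `α`, and
`direction θ φ`. -/
def frame (α θ φ : ℝ) : E3 →ₗᵢ[ℝ] E3 where
  toFun p := !₂[R α (M θ φ p) 0, R α (M θ φ p) 1,
    cos θ * sin φ * p 0 + sin θ * sin φ * p 1 + cos φ * p 2]
  map_add' p q := by ext i; fin_cases i <;> simp [M, R] <;> ring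
  map_smul' c p := by ext i; fin_cases i <;> simp [M, R] <;> ring
  norm_map' p := by
    simp only [EuclideanSpace.norm_eq, Fin.sum_univ_three, Real.norm_eq_abs, sq_abs]
    congr 1
    simp [M, R]
    have h1 := sin_sq_add_cos_sq α
    have h2 := sin_sq_add_cos_sq θ
    have h3 := sin_sq_add_cos_sq φ
    grind

theorem frame_zero_apply (θ φ : ℝ) (p : E3) :
    frame 0 θ φ p = !₂[M θ φ p 0, M θ φ p 1,
      cos θ * sin φ * p 0 + sin θ * sin φ * p 1 + cos φ * p 2] := by
  simp [frame, R]

theorem norm_direction (θ φ : ℝ) : ‖direction θ φ‖ = 1 := by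
  rw [EuclideanSpace.norm_eq, Real.sqrt_eq_one]
  simp [Fin.sum_univ_three, direction]
  have h2 := sin_sq_add_cos_sq θ
  have h3 := sin_sq_add_cos_sq φ
  grind

theorem M_direction (θ φ : ℝ) : M θ φ (direction θ φ) = 0 := by
  have h2 := sin_sq_add_cos_sq θ
  ext i; fin_cases i <;> simp [M, direction] <;> grind

theorem exists_eq_smul_direction_of_M_eq_zero {θ φ : ℝ} {p : E3} (h : M θ φ p = 0) :
    ∃ t : ℝ, p = t • direction θ φ := by
  refine ⟨cos θ * sin φ * p 0 + sin θ * sin φ * p 1 + cos φ * p 2,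
    (frame 0 θ φ).injective ?_⟩
  have h2 := sin_sq_add_cos_sq θ
  have h3 := sin_sq_add_cos_sq φ
  rw [map_smul, frame_zero_apply, frame_zero_apply, h, M_direction]
  ext i; fin_cases i <;> simp [direction]
  grind

theorem projection_surjective (θ φ : ℝ) : Function.Surjective (projection θ φ) := fun z => by
  obtain ⟨p, hp⟩ := ((frame 0 θ φ).toLinearIsometryEquiv rfl).surjective !₂[z 0, z 1, 0]
  rw [LinearIsometry.coe_toLinearIsometryEquiv, frame_zero_apply] at hp
  refine ⟨p, ?_⟩
  ext i; fin_cases i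
  · simpa using congrArg (· 0) hp
  · simpa using congrArg (· 1) hp

theorem exists_polar (a b : ℝ) : ∃ θ ∈ Set.Ico (0 : ℝ) (2 * π),
    a = √(a ^ 2 + b ^ 2) * cos θ ∧ b = √(a ^ 2 + b ^ 2) * sin θ := by
  set z : ℂ := ⟨a, b⟩
  have hz : ‖z‖ = √(a ^ 2 + b ^ 2) := by
    rw [Complex.norm_def, Complex.normSq_apply]; simp [z, pow_two]
  have h1 : a = √(a ^ 2 + b ^ 2) * cos z.arg := by
    rw [← hz, Complex.norm_mul_cos_arg]
  have h2 : b = √(a ^ 2 + b ^ 2) * sin z.arg := by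
    rw [← hz, Complex.norm_mul_sin_arg]
  have h3 := Complex.neg_pi_lt_arg z
  have h4 := Complex.arg_le_pi z
  have := pi_pos
  rcases lt_or_ge z.arg 0 with h | h
  · refine ⟨z.arg + 2 * π, ⟨by linarith, by linarith⟩, ?_, ?_⟩
    · rwa [cos_add_two_pi]
    · rwa [sin_add_two_pi]
  · exact ⟨z.arg, ⟨h, by linarith⟩, h1, h2⟩

theorem exists_spherical (a b c : ℝ) (h : a ^ 2 + b ^ 2 + c ^ 2 = 1) :
    ∃ θ ∈ Set.Ico (0 : ℝ) (2 * π), ∃ φ ∈ Set.Icc (0 : ℝ) π,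
      a = cos θ * sin φ ∧ b = sin θ * sin φ ∧ c = cos φ := by
  obtain ⟨θ, hθ, ha, hb⟩ := exists_polar a b
  have hs : sin (arccos c) = √(a ^ 2 + b ^ 2) := by
    rw [sin_arccos]; congr 1; linarith
  refine ⟨θ, hθ, arccos c, ⟨arccos_nonneg c, arccos_le_pi c⟩, ?_, ?_, ?_⟩
  · rw [hs, mul_comm, ← ha]
  · rw [hs, mul_comm, ← hb]
  · rw [cos_arccos] <;> nlinarith [sq_nonneg a, sq_nonneg b]

theorem exists_eq_norm_smul_direction (v : E3) (hv : v ≠ 0) :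
    ∃ θ ∈ Set.Ico (0 : ℝ) (2 * π), ∃ φ ∈ Set.Icc (0 : ℝ) π, v = ‖v‖ • direction θ φ := by
  have hn : ‖v‖ ≠ 0 := norm_ne_zero_iff.2 hv
  have h := EuclideanSpace.norm_sq_eq v
  simp only [Fin.sum_univ_three, Real.norm_eq_abs, sq_abs] at h
  obtain ⟨θ, hθ, φ, hφ, h0, h1, h2⟩ :=
    exists_spherical (v 0 / ‖v‖) (v 1 / ‖v‖) (v 2 / ‖v‖) (by field_simp; linarith)
  refine ⟨θ, hθ, φ, hφ, ?_⟩
  rw [direction, ← h0, ← h1, ← h2]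
  ext i; fin_cases i <;> simp <;> field_simp

/-- The spherical angles of `a × b` give `θ`, `φ`; then `a`, `b` lie in the plane spanned by the
rows of `M θ φ`, and `α` is their angle there. -/
theorem exists_angles_of_orthonormal (a₀ a₁ a₂ b₀ b₁ b₂ : ℝ)
    (ha : a₀ ^ 2 + a₁ ^ 2 + a₂ ^ 2 = 1) (hb : b₀ ^ 2 + b₁ ^ 2 + b₂ ^ 2 = 1)
    (hab : a₀ * b₀ + a₁ * b₁ + a₂ * b₂ = 0) :
    ∃ α ∈ Set.Ico (0 : ℝ) (2 * π), ∃ θ ∈ Set.Ico (0 : ℝ) (2 * π), ∃ φ ∈ Set.Icc (0 : ℝ) π,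
      a₀ = -sin θ * cos α + cos θ * cos φ * sin α ∧
      a₁ = cos θ * cos α + sin θ * cos φ * sin α ∧ a₂ = -sin φ * sin α ∧
      b₀ = -sin θ * sin α - cos θ * cos φ * cos α ∧
      b₁ = cos θ * sin α - sin θ * cos φ * cos α ∧ b₂ = sin φ * cos α := by
  obtain ⟨θ, hθ, φ, hφ, h0, h1, h2⟩ := exists_spherical (a₁ * b₂ - a₂ * b₁)
    (a₂ * b₀ - a₀ * b₂) (a₀ * b₁ - a₁ * b₀) (by
      linear_combination (b₀ ^ 2 + b₁ ^ 2 + b₂ ^ 2) * ha + hb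
        - (a₀ * b₀ + a₁ * b₁ + a₂ * b₂) * hab)
  have ht := sin_sq_add_cos_sq θ
  have hp := sin_sq_add_cos_sq φ
  -- `c` and `-s` are the coordinates of `a` along the two rows of `M θ φ`.
  obtain ⟨c, hc⟩ : ∃ c, c = -sin θ * a₀ + cos θ * a₁ := ⟨_, rfl⟩
  obtain ⟨s, hs⟩ : ∃ s, s = cos θ * cos φ * a₀ + sin θ * cos φ * a₁ - sin φ * a₂ := ⟨_, rfl⟩
  have han : a₀ * (cos θ * sin φ) + a₁ * (sin θ * sin φ) + a₂ * cos φ = 0 := by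
    rw [← h0, ← h1, ← h2]; ring
  -- With `n = a × b`, these three are `b = n × a`.
  have hb0 : b₀ = sin θ * sin φ * a₂ - cos φ * a₁ := by
    rw [← h1, ← h2]; linear_combination b₀ * (-ha) + a₀ * hab
  have hb1 : b₁ = cos φ * a₀ - cos θ * sin φ * a₂ := by
    rw [← h0, ← h2]; linear_combination b₁ * (-ha) + a₁ * hab
  have hb2 : b₂ = cos θ * sin φ * a₁ - sin θ * sin φ * a₀ := by
    rw [← h0, ← h1]; linear_combination b₂ * (-ha) + a₂ * hab
  have ha0 : a₀ = -sin θ * c + cos θ * cos φ * s := by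
    rw [hc, hs]
    linear_combination cos θ * sin φ * han - a₀ * ht
      - (cos θ ^ 2 * a₀ + sin θ * cos θ * a₁) * hp
  have ha1 : a₁ = cos θ * c + sin θ * cos φ * s := by
    rw [hc, hs]
    linear_combination sin θ * sin φ * han - a₁ * ht
      - (sin θ * cos θ * a₀ + sin θ ^ 2 * a₁) * hp
  have ha2 : a₂ = -sin φ * s := by
    rw [hs]
    linear_combination cos φ * han - a₂ * hp
  have hcs : c ^ 2 + s ^ 2 = 1 := by
    linear_combination c * hc + s * hs - a₀ * ha0 - a₁ * ha1 - a₂ * ha2 + ha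
  obtain ⟨α, hα, hcα, hsα⟩ := exists_polar c s
  rw [hcs, sqrt_one, one_mul] at hcα hsα
  refine ⟨α, hα, θ, hθ, φ, hφ, ?_⟩
  rw [← hcα, ← hsα]
  refine ⟨ha0, ha1, ha2, ?_, ?_, ?_⟩
  · rw [hb0, ha1, ha2]; linear_combination -sin θ * s * hp
  · rw [hb1, ha0, ha2]; linear_combination cos θ * s * hp
  · rw [hb2, ha0, ha1]; linear_combination sin φ * c * ht

/-- Any two orthonormal vectors are the rows of some `R α ∘ M θ φ`. -/
theorem exists_rotation_comp_M (a b : E3) (ha : inner ℝ a a = 1) (hb : inner ℝ b b = 1)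
    (hab : inner ℝ a b = 0) :
    ∃ α ∈ Set.Ico (0 : ℝ) (2 * π), ∃ θ ∈ Set.Ico (0 : ℝ) (2 * π), ∃ φ ∈ Set.Icc (0 : ℝ) π,
      ∀ p : E3, R α (M θ φ p) = !₂[inner ℝ a p, inner ℝ b p] := by
  simp only [PiLp.inner_apply, Fin.sum_univ_three, RCLike.inner_apply, conj_trivial]
    at ha hb hab ⊢
  obtain ⟨α, hα, θ, hθ, φ, hφ, ha0, ha1, ha2, hb0, hb1, hb2⟩ :=
    exists_angles_of_orthonormal (a 0) (a 1) (a 2) (b 0) (b 1) (b 2)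
      (by linear_combination ha) (by linear_combination hb) (by linear_combination hab)
  refine ⟨α, hα, θ, hθ, φ, hφ, fun p => ?_⟩
  rw [ha0, ha1, ha2, hb0, hb1, hb2]
  ext i; fin_cases i <;> simp [R, M] <;> ring

/-! ### Tunnels and congruent polyhedra -/

theorem tunnel_eq_preimage {Q : Set E3} {θ φ : ℝ} {v : E3} {r : ℝ} (hr : r ≠ 0)
    (hv : v = r • direction θ φ) :
    tunnel Q v = projection θ φ ⁻¹' convexHull ℝ (projection θ φ '' Q) := by
  have himg : projection θ φ '' convexHull ℝ Q = convexHull ℝ (projection θ φ '' Q) :=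
    (projection θ φ).toLinearMap.image_convexHull Q
  rw [← himg]
  have hv0 : projection θ φ v = 0 := by
    rw [hv, map_smul, projection_apply, M_direction, smul_zero]
  ext x
  constructor
  · rintro ⟨q, hq, t, rfl⟩
    exact ⟨q, hq, by rw [map_add, map_smul, hv0, smul_zero, add_zero]⟩
  · rintro ⟨q, hq, h⟩
    have h0 : M θ φ (x - q) = 0 := by
      rw [← projection_apply, map_sub, h, sub_self]
    obtain ⟨t, ht⟩ := exists_eq_smul_direction_of_M_eq_zero h0
    refine ⟨q, hq, t / r, ?_⟩
    rw [hv, smul_smul, div_mul_cancel₀ _ hr, ← ht, add_sub_cancel]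

theorem IsPolyhedron.nonempty {P : Set E3} (hP : IsPolyhedron P) : P.Nonempty := by
  rw [Set.nonempty_iff_ne_empty]
  rintro rfl
  have := hP.nondegenerate
  rw [AffineSubspace.span_empty] at this
  exact bot_ne_top this

theorem IsPolyhedron.image {P : Set E3} (hP : IsPolyhedron P) (g : E3 ≃ᵃⁱ[ℝ] E3) :
    IsPolyhedron (g '' P) where
  finite := hP.finite.image g
  nondegenerate := by
    exact g.toAffineEquiv.span_eq_top_iff.1 hP.nondegenerate
  convexPosition := by
    have h := hP.convexPosition
    rw [convexIndependent_set_iff_inter_convexHull_subset] at h ⊢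
    intro t' ht'
    obtain ⟨t, ht, rfl⟩ := Set.subset_image_iff.1 ht'
    have himg : g '' convexHull ℝ t = convexHull ℝ (g '' t) :=
      g.toAffineEquiv.toAffineMap.image_convexHull t
    rw [← himg, ← Set.image_inter g.injective]
    exact Set.image_mono (h t ht)

theorem hasHole_iff_image_subset {P Q : Set E3} (hP : IsPolyhedron P) (hQ : IsPolyhedron Q)
    {θ φ : ℝ} {v : E3} {r : ℝ} (hr : r ≠ 0) (hv : v = r • direction θ φ) :
    HasHole (convexHull ℝ P \ tunnel Q v) ↔
      M θ φ '' Q ⊆ polygonInterior (M θ φ '' P) := by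
  let e : E2 ≃L[ℝ] ℂ := Complex.orthonormalBasisOneI.repr.symm.toContinuousLinearEquiv
  let p : E3 →L[ℝ] ℂ := (e : E2 →L[ℝ] ℂ).comp (projection θ φ)
  have hp : Function.Surjective p := e.surjective.comp (projection_surjective θ φ)
  set B := convexHull ℝ (projection θ φ '' Q)
  have hpre : tunnel Q v = p ⁻¹' (e '' B) := by
    rw [tunnel_eq_preimage hr hv, show (p : E3 → ℂ) = e ∘ projection θ φ from rfl,
      Set.preimage_comp, e.injective.preimage_image]
  have hB : IsCompact B := (hQ.finite.image _).isCompact_convexHull ℝ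
  have hBe : Convex ℝ (e '' B) :=
    (convex_convexHull ℝ _).linear_image e.toLinearEquiv.toLinearMap
  have hne : (interior (convexHull ℝ P)).Nonempty :=
    interior_convexHull_nonempty_iff_affineSpan_eq_top.2 hP.nondegenerate
  have himg : p '' convexHull ℝ P = e '' convexHull ℝ (projection θ φ '' P) := by
    rw [show (p : E3 → ℂ) = e ∘ projection θ φ from rfl, Set.image_comp]
    congr 1
    exact (projection θ φ).toLinearMap.image_convexHull P
  rw [hpre, hasHole_sdiff_preimage_iff p hp (convex_convexHull ℝ P) hne hBe
    (hB.image e.continuous) (((hQ.nonempty.image _).convexHull).image e), himg,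
    ← show e '' interior _ = interior (e '' _) from e.toHomeomorph.image_interior _,
    Set.image_subset_image_iff e.injective]
  -- The interior is convex, so containing the vertices suffices.
  exact (convex_convexHull ℝ _).interior.convexHull_subset_iff

theorem image_eq_of_forall {P : Set E3} {θ₁ φ₁ θ₂ φ₂ x y α : ℝ} {g : E3 → E3}
    (h : ∀ p, M θ₂ φ₂ (g p) = T x y (R α (M θ₁ φ₁ p))) :
    (T x y ∘ R α ∘ M θ₁ φ₁) '' P = M θ₂ φ₂ '' (g '' P) := by
  rw [Set.image_image]
  exact Set.image_congr fun p _ => (h p).symm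

/-- The linear part of `g` pulls the rows of `M θ φ` back to an orthonormal pair. Reflections cause
no trouble, since a pair of vectors in space carries no orientation constraint. -/
theorem exists_forall_M_isometry_eq (g : E3 ≃ᵃⁱ[ℝ] E3) (θ φ : ℝ) :
    ∃ x y : ℝ, ∃ α ∈ Set.Ico (0 : ℝ) (2 * π), ∃ θ₁ ∈ Set.Ico (0 : ℝ) (2 * π),
      ∃ φ₁ ∈ Set.Icc (0 : ℝ) π, ∀ p, M θ φ (g p) = T x y (R α (M θ₁ φ₁ p)) := by
  let O := g.linearIsometryEquiv
  let a : E3 := !₂[-sin θ, cos θ, 0]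
  let b : E3 := !₂[-cos θ * cos φ, -sin θ * cos φ, sin φ]
  have h1 := sin_sq_add_cos_sq θ
  have h2 := sin_sq_add_cos_sq φ
  obtain ⟨α, hα, θ₁, hθ₁, φ₁, hφ₁, h⟩ := exists_rotation_comp_M (O.symm a) (O.symm b)
    (by rw [O.symm.inner_map_map, PiLp.inner_apply, Fin.sum_univ_three]; simp [a])
    (by rw [O.symm.inner_map_map, PiLp.inner_apply, Fin.sum_univ_three]; simp [b]; grind)
    (by rw [O.symm.inner_map_map]; simp [a, b, PiLp.inner_apply, Fin.sum_univ_three]; grind)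
  refine ⟨M θ φ (g 0) 0, M θ φ (g 0) 1, α, hα, θ₁, hθ₁, φ₁, hφ₁, fun p => ?_⟩
  have hg : g p = O p + g 0 := by
    have := g.map_vadd 0 p
    simpa using this
  have hadj : ∀ c : E3, inner ℝ (O.symm c) p = inner ℝ c (O p) := fun c => by
    rw [← O.inner_map_map, O.apply_symm_apply]
  rw [h p, hadj, hadj, hg, ← projection_apply, map_add, projection_apply, projection_apply]
  ext i; fin_cases i <;>
    simp [T, M, a, b, PiLp.inner_apply, Fin.sum_univ_three] <;> ring

/-- Pass to the first frame, shift by `(x, y, 0)`, and return through the second; `M` reads off the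
first two frame coordinates. -/
theorem exists_isometry_forall_M_eq (x y α θ₁ φ₁ θ₂ φ₂ : ℝ) :
    ∃ g : E3 ≃ᵃⁱ[ℝ] E3, ∀ p, M θ₂ φ₂ (g p) = T x y (R α (M θ₁ φ₁ p)) := by
  let F₁ := (frame α θ₁ φ₁).toLinearIsometryEquiv rfl
  let F₂ := (frame 0 θ₂ φ₂).toLinearIsometryEquiv rfl
  refine ⟨F₁.toAffineIsometryEquiv.trans
    ((AffineIsometryEquiv.constVAdd ℝ E3 (!₂[x, y, 0] : E3)).trans
      F₂.symm.toAffineIsometryEquiv), fun p => ?_⟩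
  set q := (F₁.toAffineIsometryEquiv.trans
    ((AffineIsometryEquiv.constVAdd ℝ E3 (!₂[x, y, 0] : E3)).trans
      F₂.symm.toAffineIsometryEquiv)) p
  have h : frame 0 θ₂ φ₂ q = !₂[x, y, 0] + frame α θ₁ φ₁ p := F₂.apply_symm_apply _
  rw [frame_zero_apply] at h
  ext i; fin_cases i
  · simpa [frame, T, add_comm] using congrArg (· 0) h
  · simpa [frame, T, add_comm] using congrArg (· 1) h

end Rupert

end

theorem mainTheorem6 (P : Set Rupert.E3) (hP : Rupert.IsPolyhedron P) :
    Rupert.IsRupert P ↔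
      ∃ x y : ℝ, ∃ α ∈ Set.Ico (0 : ℝ) (2 * Real.pi),
        ∃ θ₁ ∈ Set.Ico (0 : ℝ) (2 * Real.pi), ∃ θ₂ ∈ Set.Ico (0 : ℝ) (2 * Real.pi),
        ∃ φ₁ ∈ Set.Icc (0 : ℝ) Real.pi, ∃ φ₂ ∈ Set.Icc (0 : ℝ) Real.pi,
          (Rupert.T x y ∘ Rupert.R α ∘ Rupert.M θ₁ φ₁) '' P ⊆
            Rupert.polygonInterior (Rupert.M θ₂ φ₂ '' P) := by
  constructor
  · rintro ⟨Q, hQ, ⟨g, rfl⟩, v, hv, hole⟩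
    obtain ⟨θ₂, hθ₂, φ₂, hφ₂, hvd⟩ := Rupert.exists_eq_norm_smul_direction v hv
    -- By Mazur–Ulam the isometry `g` is affine.
    obtain ⟨x, y, α, hα, θ₁, hθ₁, φ₁, hφ₁, h⟩ :=
      Rupert.exists_forall_M_isometry_eq g.toRealAffineIsometryEquiv θ₂ φ₂
    refine ⟨x, y, α, hα, θ₁, hθ₁, θ₂, hθ₂, φ₁, hφ₁, φ₂, hφ₂, ?_⟩
    rw [Rupert.image_eq_of_forall h]
    exact (Rupert.hasHole_iff_image_subset hP hQ (norm_ne_zero_iff.2 hv) hvd).1 hole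
  · rintro ⟨x, y, α, -, θ₁, -, θ₂, -, φ₁, -, φ₂, -, hsub⟩
    obtain ⟨g, hg⟩ := Rupert.exists_isometry_forall_M_eq x y α θ₁ φ₁ θ₂ φ₂
    rw [Rupert.image_eq_of_forall hg] at hsub
    refine ⟨g '' P, hP.image g, ⟨g.toIsometryEquiv, rfl⟩, Rupert.direction θ₂ φ₂,
      norm_ne_zero_iff.1 (by rw [Rupert.norm_direction]; exact one_ne_zero), ?_⟩
    exact (Rupert.hasHole_iff_image_subset hP (hP.image g) one_ne_zero (one_smul ℝ _).symm).2 hsub
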